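/- Let $X$ be a topological space. A real singular $n$-chain in $X$ is a finite formal linear combination $c=\sum_i \alpha_i\sigma_i$ with $\alpha_i\in\mathbb{R}$ and $\sigma_i\colon\Delta^n\to X$ distinct continuous maps; its $\ell^1$-norm is $\|c\|_1=\sum_i|\alpha_i|$, and $\partial$ denotes the usual singular boundary operator. A $d$-dimensional torus is a space homeomorphic to $(\mathbb{R}/\mathbb{Z})^d$. Lemma 3.6. For every integer $d\ge 1$ and every integer $s\ge 0$ there is a constant $K(d,s)$, depending only on $d$ and $s$, such that for every $d$-dimensional torus $T$ and every null-homologous real singular $s$-cycle $z$ in $T$ there is a real singular $(s+1)$-chain $c$ in $T$ with $\partial c=z$ and $$\|c\|_1\le K(d,s)\,\|z\|_1 .$$ -/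

import Mathlib

/-- A singular `n`-simplex in `X`: a continuous map from the standard `n`-simplex to `X`. -/
abbrev SingularSimplex (n : ℕ) (X : Type*) [TopologicalSpace X] : Type _ :=
  C(stdSimplex ℝ (Fin (n + 1)), X)

/-- The `i`-th face of a singular simplex: its restriction to the face opposite to the
`i`-th vertex, parametrised by the order-preserving affine map of standard simplices. -/
noncomputable def SingularSimplex.face {n : ℕ} {X : Type*} [TopologicalSpace X]
    (σ : SingularSimplex (n + 1) X) (i : Fin (n + 2)) : SingularSimplex n X :=
  ContinuousMap.comp σ ⟨stdSimplex.map (Fin.succAbove i), stdSimplex.continuous_map _⟩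

/-- Real singular `n`-chains in `X`: finite formal real linear combinations of
singular `n`-simplices. -/
abbrev SingularChain (n : ℕ) (X : Type*) [TopologicalSpace X] : Type _ :=
  SingularSimplex n X →₀ ℝ

namespace SingularChain

variable {n : ℕ} {X : Type*} [TopologicalSpace X]

/-- The singular boundary operator, the linear map with
`∂ σ = ∑ i, (-1) ^ i • (i-th face of σ)` on every singular simplex `σ`. -/
noncomputable def boundary (n : ℕ) (X : Type*) [TopologicalSpace X] :
    SingularChain (n + 1) X →ₗ[ℝ] SingularChain n X :=
  Finsupp.linearCombination ℝ fun σ : SingularSimplex (n + 1) X =>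
    ∑ i : Fin (n + 2), Finsupp.single (SingularSimplex.face σ i) ((-1 : ℝ) ^ (i : ℕ))

/-- `z` is a cycle: its boundary vanishes. The boundary of a `0`-chain is zero by convention
(homology is not reduced). -/
def IsCycle : {n : ℕ} → SingularChain n X → Prop
  | 0, _ => True
  | m + 1, z => boundary m X z = 0

/-- `z` is null-homologous: it is the boundary of some singular chain. -/
def IsNullHomologous (z : SingularChain n X) : Prop :=
  z ∈ LinearMap.range (boundary n X)

/-- The `ℓ¹`-norm of a chain: the sum of the absolute values of its coefficients. -/
noncomputable def l1Norm (c : SingularChain n X) : ℝ :=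
  c.sum fun _ a => |a|

end SingularChain

/-- `T` is a `d`-dimensional torus: it is homeomorphic to the product of `d` circles `ℝ ⧸ ℤ`. -/
def IsTorus (d : ℕ) (T : Type*) [TopologicalSpace T] : Prop :=
  Nonempty (T ≃ₜ (Fin d → UnitAddCircle))

/-! Coning fills cycles in $\mathbb{R}^d$ without increasing the norm, but a cycle in the torus need
not lift to a cycle: opposite faces may lift to different translates. Write $z=\partial c$ and lift
$c$ to a chain $b$ in $\mathbb{R}^d$. Average the cones over $\partial b$ with apices in a large
integer cube and project to the torus. The cone formula shows that the result still has boundary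
$z$. Its norm is governed by $z$, not by $\partial b$. Translating a simplex by $g\in\mathbb{Z}^d$
amounts, after projection, to translating the apices, and large cubes are almost invariant under
$g$. So replacing each simplex of $\partial b$ by a fixed lift of its projection costs less than
$\varepsilon$ (`exists_l1Norm_pushCone_le`), giving a filling of norm at most $\|z\|_1+\varepsilon$
(`exists_boundary_eq_l1Norm_le_add`). -/

open Filter Topology

/-! ### Singular chains: boundary, push-forward, norm -/

namespace SingularSimplex

theorem face_face {n : ℕ} {X : Type*} [TopologicalSpace X] (σ : SingularSimplex (n + 2) X)
    {i : Fin (n + 2)} {j : Fin (n + 3)} (h : j ≤ i.castSucc) :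
    (σ.face j).face i =
      (σ.face i.succ).face (j.castLT (lt_of_le_of_lt (Fin.le_def.mp h) i.isLt)) := by
  ext t
  simp only [face, ContinuousMap.comp_apply, ContinuousMap.coe_mk, stdSimplex.map_comp_apply]
  congr 2
  funext k
  simp only [Fin.succAbove, Function.comp_apply, Fin.ext_iff, Fin.lt_def, Fin.le_def] at h ⊢
  split_ifs <;> simp_all <;> omega

end SingularSimplex

namespace SingularChain

variable {n : ℕ} {X Y : Type*} [TopologicalSpace X] [TopologicalSpace Y]

theorem boundary_single (σ : SingularSimplex (n + 1) X) (a : ℝ) :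
    boundary n X (Finsupp.single σ a) =
      a • ∑ i : Fin (n + 2), Finsupp.single (σ.face i) ((-1 : ℝ) ^ (i : ℕ)) := by
  simp [boundary, Finsupp.linearCombination_single]

theorem boundary_boundary (c : SingularChain (n + 2) X) :
    boundary n X (boundary (n + 1) X c) = 0 := by
  induction c using Finsupp.induction_linear with
  | zero => simp
  | add f g hf hg => simp [hf, hg]
  | single σ a =>
    rw [boundary_single, map_smul, map_sum]
    refine smul_eq_zero_of_right a ?_
    simp only [boundary_single, Finset.smul_sum, Finsupp.smul_single, smul_eq_mul]
    rw [Finset.sum_comm]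
    simp only [← Finset.sum_product']
    let P := Fin (n + 2) × Fin (n + 3)
    let S : Finset P := {ij : P | (ij.2 : ℕ) ≤ (ij.1 : ℕ)}
    rw [Finset.univ_product_univ, ← Finset.sum_add_sum_compl S, ← eq_neg_iff_add_eq_zero,
      ← Finset.sum_neg_distrib]
    -- The pairing $(i,j)\mapsto(j,i+1)$ preserves the iterated face and changes the parity of
    -- $i+j$, so paired terms cancel.
    let φ : ∀ ij : P, ij ∈ S → P := fun ij hij =>
      (Fin.castLT ij.2 (lt_of_le_of_lt (Finset.mem_filter.mp hij).right (Fin.is_lt ij.1)),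
        ij.1.succ)
    apply Finset.sum_bij φ
    · intro ij hij
      simp_rw [S, φ, Finset.compl_filter, Finset.mem_filter_univ, Fin.val_succ,
        Fin.val_castLT] at hij ⊢
      lia
    · rintro ⟨i, j⟩ hij ⟨i', j'⟩ hij' h
      rw [Prod.mk_inj]
      exact ⟨by simpa [φ] using! congr_arg Prod.snd h,
        by simpa [φ, Fin.castSucc_castLT] using! congr_arg Fin.castSucc (congr_arg Prod.fst h)⟩
    · rintro ⟨i', j'⟩ hij'
      simp_rw [S, Finset.compl_filter, Finset.mem_filter_univ, not_le] at hij'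
      refine ⟨(j'.pred <| ?_, Fin.castSucc i'), ?_, ?_⟩
      · rintro rfl
        simp only [Fin.val_zero, not_lt_zero] at hij'
      · simpa [S] using! Nat.le_sub_one_of_lt hij'
      · simp only [φ, Fin.castLT_castSucc, Fin.succ_pred]
    · rintro ⟨i, j⟩ hij
      have h : j ≤ i.castSucc := by simpa [S] using! hij
      simp only [φ, SingularSimplex.face_face σ h, ← Finsupp.single_neg]
      congr 1
      simp only [Fin.val_succ, Fin.val_castLT, pow_succ]
      ring

/-- The chain map induced by a continuous map. -/
noncomputable def push (n : ℕ) (f : C(X, Y)) : SingularChain n X →ₗ[ℝ] SingularChain n Y :=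
  Finsupp.lmapDomain ℝ ℝ fun σ : SingularSimplex n X => f.comp σ

@[simp]
theorem push_single (f : C(X, Y)) (σ : SingularSimplex n X) (a : ℝ) :
    push n f (Finsupp.single σ a) = Finsupp.single (f.comp σ) a :=
  Finsupp.mapDomain_single

theorem boundary_push (f : C(X, Y)) (c : SingularChain (n + 1) X) :
    boundary n Y (push (n + 1) f c) = push n f (boundary n X c) := by
  induction c using Finsupp.induction_linear with
  | zero => simp
  | add c c' hc hc' => simp only [map_add, hc, hc']
  | single σ a =>
    simp only [push_single, boundary_single, map_smul, map_sum]
    rfl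

theorem l1Norm_eq_sum_of_subset {c : SingularChain n X} {s : Finset (SingularSimplex n X)}
    (h : c.support ⊆ s) : l1Norm c = ∑ σ ∈ s, |c σ| :=
  Finsupp.sum_of_support_subset c h _ (by simp)

@[simp]
theorem l1Norm_zero : l1Norm (0 : SingularChain n X) = 0 := by simp [l1Norm]

theorem l1Norm_nonneg (c : SingularChain n X) : 0 ≤ l1Norm c :=
  Finset.sum_nonneg fun _ _ => abs_nonneg _

theorem l1Norm_pos {c : SingularChain n X} (h : c ≠ 0) : 0 < l1Norm c :=
  Finset.sum_pos (fun _ hσ => abs_pos.mpr (Finsupp.mem_support_iff.mp hσ))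
    (Finsupp.support_nonempty_iff.mpr h)

@[simp]
theorem l1Norm_single (σ : SingularSimplex n X) (a : ℝ) :
    l1Norm (Finsupp.single σ a) = |a| := by simp [l1Norm]

theorem l1Norm_add_le (c c' : SingularChain n X) : l1Norm (c + c') ≤ l1Norm c + l1Norm c' := by
  classical
  rw [l1Norm_eq_sum_of_subset (Finsupp.support_add (g₁ := c) (g₂ := c')),
    l1Norm_eq_sum_of_subset (c := c) Finset.subset_union_left,
    l1Norm_eq_sum_of_subset (c := c') Finset.subset_union_right, ← Finset.sum_add_distrib]
  exact Finset.sum_le_sum fun σ _ => abs_add_le _ _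

theorem l1Norm_smul (a : ℝ) (c : SingularChain n X) : l1Norm (a • c) = |a| * l1Norm c := by
  rw [l1Norm_eq_sum_of_subset (Finsupp.support_smul (b := a) (g := c)), l1Norm, Finsupp.sum,
    Finset.mul_sum]
  simp [abs_mul]

theorem l1Norm_sub_le (c c' : SingularChain n X) : l1Norm (c - c') ≤ l1Norm c + l1Norm c' := by
  have h := l1Norm_add_le c ((-1 : ℝ) • c')
  rwa [l1Norm_smul, abs_neg, abs_one, one_mul, neg_one_smul, ← sub_eq_add_neg] at h

theorem l1Norm_sum_le {ι : Type*} (s : Finset ι) (f : ι → SingularChain n X) :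
    l1Norm (∑ i ∈ s, f i) ≤ ∑ i ∈ s, l1Norm (f i) :=
  Finset.le_sum_of_subadditive _ l1Norm_zero.le l1Norm_add_le s f

/-- A linear map is bounded on a chain by its values on the simplices of that chain. -/
theorem l1Norm_map_le {m : ℕ} (φ : SingularChain n X →ₗ[ℝ] SingularChain m Y)
    (c : SingularChain n X) :
    l1Norm (φ c) ≤ c.sum fun σ a => |a| * l1Norm (φ (Finsupp.single σ 1)) := by
  have h : φ c = c.sum fun σ a => a • φ (Finsupp.single σ 1) := by
    conv_lhs => rw [← Finsupp.sum_single c]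
    rw [map_finsuppSum]
    refine Finsupp.sum_congr fun σ _ => ?_
    rw [← map_smul, Finsupp.smul_single, smul_eq_mul, mul_one]
  rw [h]
  refine (l1Norm_sum_le _ _).trans_eq (Finset.sum_congr rfl fun σ _ => ?_)
  exact l1Norm_smul _ _

theorem l1Norm_map_le_of_le_one {m : ℕ} (φ : SingularChain n X →ₗ[ℝ] SingularChain m Y)
    (h : ∀ σ, l1Norm (φ (Finsupp.single σ 1)) ≤ 1) (c : SingularChain n X) :
    l1Norm (φ c) ≤ l1Norm c :=
  (l1Norm_map_le φ c).trans <| Finset.sum_le_sum fun σ _ =>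
    mul_le_of_le_one_right (abs_nonneg _) (h σ)

end SingularChain

/-! ### Cones over singular simplices in a normed space -/

namespace stdSimplex

variable {n : ℕ}

/-- The radial projection from the vertex `0` to the opposite face, with an arbitrary value at the
vertex itself. -/
noncomputable def project (t : stdSimplex ℝ (Fin (n + 2))) : stdSimplex ℝ (Fin (n + 1)) :=
  if h : t 0 = 1 then Classical.arbitrary _ else
    ⟨fun i => t i.succ / (1 - t 0),
      fun i => div_nonneg (zero_le t _) (sub_nonneg.mpr (le_one t 0)), by
      have hs := sum_eq_one t
      rw [Fin.sum_univ_succ] at hs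
      change ∑ i : Fin (n + 1), t i.succ / (1 - t 0) = 1
      rw [← Finset.sum_div, eq_sub_of_add_eq' hs]
      exact div_self (sub_ne_zero.mpr (Ne.symm h))⟩

theorem project_apply {t : stdSimplex ℝ (Fin (n + 2))} (h : t 0 ≠ 1) (i : Fin (n + 1)) :
    project t i = t i.succ / (1 - t 0) := by
  rw [project, dif_neg h]
  rfl

theorem continuous_apply (i : Fin (n + 1)) :
    Continuous fun t : stdSimplex ℝ (Fin (n + 1)) => t i :=
  (_root_.continuous_apply i).comp continuous_subtype_val

theorem continuousAt_project {t : stdSimplex ℝ (Fin (n + 2))} (h : t 0 ≠ 1) :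
    ContinuousAt project t := by
  rw [Topology.IsInducing.subtypeVal.continuousAt_iff, continuousAt_pi]
  intro i
  have hc : ContinuousAt (fun u : stdSimplex ℝ (Fin (n + 2)) => u i.succ / (1 - u 0)) t :=
    (continuous_apply i.succ).continuousAt.div
      (continuousAt_const.sub (continuous_apply 0).continuousAt) (sub_ne_zero.mpr (Ne.symm h))
  refine hc.congr ?_
  filter_upwards [(continuous_apply 0).continuousAt.eventually_ne h] with u hu
  exact (project_apply hu i).symm

theorem map_succAbove_self (i : Fin (n + 2)) (t : stdSimplex ℝ (Fin (n + 1))) :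
    map i.succAbove t i = 0 := by
  rw [map_coe, FunOnFinite.linearMap_apply_apply]
  refine Finset.sum_eq_zero fun j hj => ?_
  exact absurd (Finset.mem_filter.mp hj).2 (Fin.succAbove_ne i j)

theorem map_succAbove_succAbove (i : Fin (n + 2)) (t : stdSimplex ℝ (Fin (n + 1)))
    (j : Fin (n + 1)) : map i.succAbove t (i.succAbove j) = t j := by
  rw [map_coe, FunOnFinite.linearMap_apply_apply]
  have : ({x | i.succAbove x = i.succAbove j} : Finset (Fin (n + 1))) = {j} := by
    ext x
    simp
  rw [this, Finset.sum_singleton]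

theorem map_succ_succAbove_zero (i : Fin (n + 2)) (t : stdSimplex ℝ (Fin (n + 2))) :
    map i.succ.succAbove t 0 = t 0 := by
  rw [← Fin.succ_succAbove_zero i, map_succAbove_succAbove]

theorem project_map_zero_succAbove (t : stdSimplex ℝ (Fin (n + 1))) :
    project (map (Fin.succAbove 0) t) = t := by
  ext j
  rw [project_apply (by rw [map_succAbove_self]; exact zero_ne_one), map_succAbove_self, ← Fin.succAbove_zero_apply,
    map_succAbove_succAbove, sub_zero, div_one]

theorem project_map_succ_succAbove (i : Fin (n + 2)) {t : stdSimplex ℝ (Fin (n + 2))}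
    (h : t 0 ≠ 1) : project (map i.succ.succAbove t) = map i.succAbove (project t) := by
  ext j
  rw [project_apply (by rwa [map_succ_succAbove_zero]), map_succ_succAbove_zero]
  rcases Fin.eq_self_or_eq_succAbove i j with rfl | ⟨k, rfl⟩
  · rw [map_succAbove_self, map_succAbove_self, zero_div]
  · rw [map_succAbove_succAbove, ← Fin.succ_succAbove_succ, map_succAbove_succAbove,
      project_apply h]

end stdSimplex

namespace SingularSimplex

variable {n : ℕ} {E : Type*} [NormedAddCommGroup E] [NormedSpace ℝ E]

/-- The cone over a singular simplex with apex `v`. -/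
noncomputable def cone (v : E) (σ : SingularSimplex n E) : SingularSimplex (n + 1) E where
  toFun t := v + (1 - t 0) • (σ (stdSimplex.project t) - v)
  continuous_toFun := by
    refine continuous_const.add (continuous_iff_continuousAt.mpr fun t => ?_)
    have h0 : ContinuousAt (fun u : stdSimplex ℝ (Fin (n + 2)) => 1 - u 0) t :=
      continuousAt_const.sub (stdSimplex.continuous_apply 0).continuousAt
    by_cases h : t 0 = 1
    · rw [ContinuousAt, h, sub_self, zero_smul]
      rw [ContinuousAt, h, sub_self] at h0
      -- At the apex the scalar tends to zero and the other factor is bounded by compactness, so the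
      -- arbitrary value of `project` there is harmless.
      refine h0.zero_smul_isBoundedUnder_le ?_
      obtain ⟨C, hC⟩ :=
        (isCompact_range (σ - ContinuousMap.const _ v).continuous).isBounded.exists_norm_le
      exact isBoundedUnder_of ⟨C, fun u => hC _ ⟨stdSimplex.project u, rfl⟩⟩
    · exact h0.smul (((map_continuous σ).continuousAt.comp
        (stdSimplex.continuousAt_project h)).sub continuousAt_const)

theorem cone_apply (v : E) (σ : SingularSimplex n E) (t : stdSimplex ℝ (Fin (n + 2))) :
    cone v σ t = v + (1 - t 0) • (σ (stdSimplex.project t) - v) := rfl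

theorem face_zero_cone (v : E) (σ : SingularSimplex n E) : (cone v σ).face 0 = σ := by
  ext t
  change cone v σ (stdSimplex.map (Fin.succAbove 0) t) = σ t
  rw [cone_apply, stdSimplex.project_map_zero_succAbove, stdSimplex.map_succAbove_self]
  simp

theorem face_succ_cone (v : E) (σ : SingularSimplex (n + 1) E) (i : Fin (n + 2)) :
    (cone v σ).face i.succ = cone v (σ.face i) := by
  ext t
  change cone v σ (stdSimplex.map i.succ.succAbove t) =
    v + (1 - t 0) • (σ (stdSimplex.map i.succAbove (stdSimplex.project t)) - v)
  rw [cone_apply, stdSimplex.map_succ_succAbove_zero]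
  by_cases h : t 0 = 1
  · simp [h]
  · rw [stdSimplex.project_map_succ_succAbove i h]

/-- This equivariance trades a translation of the simplex for a translation of the apex. -/
theorem cone_add_const (v w : E) (σ : SingularSimplex n E) :
    cone (v + w) (σ + ContinuousMap.const _ w) = cone v σ + ContinuousMap.const _ w := by
  ext t
  simp only [cone_apply, ContinuousMap.add_apply, ContinuousMap.const_apply,
    add_sub_add_right_eq_sub]
  abel

end SingularSimplex

namespace SingularChain

variable {n : ℕ} {E : Type*} [NormedAddCommGroup E] [NormedSpace ℝ E]

/-- The linear extension of the cone construction to singular chains. -/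
noncomputable def cone (n : ℕ) (v : E) : SingularChain n E →ₗ[ℝ] SingularChain (n + 1) E :=
  Finsupp.lmapDomain ℝ ℝ (SingularSimplex.cone v)

@[simp]
theorem cone_single (v : E) (σ : SingularSimplex n E) (a : ℝ) :
    cone n v (Finsupp.single σ a) = Finsupp.single (SingularSimplex.cone v σ) a :=
  Finsupp.mapDomain_single

/-- The apex is vertex 0, so face 0 is the base and the other faces are cones over its faces, with
signs shifted by one. In degree 0 an augmentation term would appear. -/
theorem boundary_cone (v : E) (c : SingularChain (n + 1) E) :
    boundary (n + 1) E (cone (n + 1) v c) = c - cone n v (boundary n E c) := by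
  induction c using Finsupp.induction_linear with
  | zero => simp
  | add c c' hc hc' =>
    simp only [map_add, hc, hc']
    abel
  | single σ a =>
    rw [cone_single, boundary_single, boundary_single, map_smul, map_sum, Fin.sum_univ_succ,
      SingularSimplex.face_zero_cone]
    simp only [cone_single, SingularSimplex.face_succ_cone, Fin.val_succ, pow_succ, mul_neg,
      mul_one, Finsupp.single_neg, Finset.sum_neg_distrib, smul_add, smul_neg, Finsupp.smul_single,
      Fin.val_zero, pow_zero, smul_eq_mul, sub_eq_add_neg]

/-- The average of the cones with apices in `F`. -/
noncomputable def coneAverage (n : ℕ) {ι : Type*} (F : Finset ι) (p : ι → E) :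
    SingularChain n E →ₗ[ℝ] SingularChain (n + 1) E :=
  (F.card : ℝ)⁻¹ • ∑ g ∈ F, cone n (p g)

theorem coneAverage_apply {ι : Type*} (F : Finset ι) (p : ι → E) (c : SingularChain n E) :
    coneAverage n F p c = (F.card : ℝ)⁻¹ • ∑ g ∈ F, cone n (p g) c := by
  simp [coneAverage]

theorem boundary_coneAverage {ι : Type*} {F : Finset ι} (hF : F.Nonempty) (p : ι → E)
    (c : SingularChain (n + 1) E) :
    boundary (n + 1) E (coneAverage (n + 1) F p c) =
      c - coneAverage n F p (boundary n E c) := by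
  have h : (F.card : ℝ) ≠ 0 := Nat.cast_ne_zero.mpr hF.card_ne_zero
  simp only [coneAverage_apply, map_smul, map_sum, boundary_cone, Finset.sum_sub_distrib,
    Finset.sum_const, smul_sub]
  rw [← Nat.cast_smul_eq_nsmul ℝ, inv_smul_smul₀ h]

end SingularChain

/-! ### Følner cubes in $\mathbb{Z}^d$ -/

/-- The cube `[0, N)^d` in `ℤ^d`. -/
noncomputable def intBox (d N : ℕ) : Finset (Fin d → ℤ) :=
  Fintype.piFinset fun _ => Finset.Ico (0 : ℤ) N

theorem card_intBox (d N : ℕ) : (intBox d N).card = N ^ d := by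
  simp [intBox]

theorem map_addRight_intBox (d N : ℕ) (g : Fin d → ℤ) :
    (intBox d N).map (addRightEmbedding g) =
      Fintype.piFinset fun i => Finset.Ico (g i) (N + g i) := by
  ext v
  simp only [intBox, Finset.mem_map, Fintype.mem_piFinset, Finset.mem_Ico, addRightEmbedding_apply]
  constructor
  · rintro ⟨w, hw, rfl⟩ i
    have := hw i
    simp only [Pi.add_apply]
    omega
  · intro h
    refine ⟨v - g, fun i => ?_, sub_add_cancel v g⟩
    have := h i
    simp only [Pi.sub_apply]
    omega

/-- The cubes form a Følner sequence of `ℤ^d`. -/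
theorem tendsto_card_intBox_sdiff (d : ℕ) (g : Fin d → ℤ) :
    Tendsto (fun N : ℕ => (((intBox d N) \ (intBox d N).map (addRightEmbedding g)).card : ℝ) /
      (intBox d N).card) atTop (𝓝 0) := by
  -- In one coordinate the overlap has $N-|a|$ points once $N>|a|$; the overlap of cubes is the
  -- product of these.
  have key (a : ℤ) : Tendsto (fun N : ℕ =>
      ((Finset.Ico (0 : ℤ) N ∩ Finset.Ico a (N + a)).card : ℝ) / N) atTop (𝓝 1) := by
    have h : Tendsto (fun N : ℕ => 1 - |(a : ℝ)| / N) atTop (𝓝 (1 - 0)) :=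
      (tendsto_const_div_atTop_nhds_zero_nat _).const_sub 1
    rw [sub_zero] at h
    refine h.congr' ?_
    filter_upwards [eventually_ge_atTop (a.natAbs + 1)] with N hN
    have hc : ((Finset.Ico (0 : ℤ) N ∩ Finset.Ico a (N + a)).card : ℤ) = N - |a| := by
      rw [Finset.Ico_inter_Ico, Int.card_Ico]
      rcases abs_cases a with ⟨h1, h2⟩ | ⟨h1, h2⟩ <;> rw [h1] <;> simp only [max_def, min_def] <;>
        split_ifs <;> omega
    have hc' : ((Finset.Ico (0 : ℤ) N ∩ Finset.Ico a (N + a)).card : ℝ) = N - |(a : ℝ)| := by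
      exact_mod_cast hc
    have hN0 : (N : ℝ) ≠ 0 := by
      have : N ≠ 0 := by omega
      exact_mod_cast this
    rw [hc', sub_div, div_self hN0]
  have hprod := tendsto_finsetProd (Finset.univ : Finset (Fin d)) fun i _ => key (g i)
  have := hprod.const_sub 1
  simp only [Finset.prod_const_one, sub_self] at this
  refine this.congr' ?_
  filter_upwards [eventually_ge_atTop 1] with N hN
  have hN0 : (N : ℝ) ≠ 0 := by
    have : N ≠ 0 := by omega
    exact_mod_cast this
  have hinter : ((intBox d N) ∩ (intBox d N).map (addRightEmbedding g)).card =
      ∏ i, (Finset.Ico (0 : ℤ) N ∩ Finset.Ico (g i) (N + g i)).card := by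
    rw [map_addRight_intBox, intBox, ← Fintype.piFinset_inter, Fintype.card_piFinset]
  have hcard := Finset.card_sdiff_add_card_inter (intBox d N)
    ((intBox d N).map (addRightEmbedding g))
  rw [hinter, card_intBox] at hcard
  have hcard' := congrArg (Nat.cast (R := ℝ)) hcard
  push_cast at hcard'
  rw [eq_sub_of_add_eq hcard', card_intBox]
  push_cast
  rw [sub_div, div_self (pow_ne_zero _ hN0), Finset.prod_div_distrib]
  simp

/-! ### Averaged cones projected to the torus -/

namespace SingularChain

variable {n d : ℕ} {T : Type*} [TopologicalSpace T]

/-- The terms over $F\cap(F+g)$ cancel, and the two remaining differences have equal cardinality. -/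
theorem l1Norm_sum_translate_sub_sum_le {X ι : Type*} [TopologicalSpace X] [AddGroup ι]
    [DecidableEq ι] (F : Finset ι) (g : ι) (f : ι → SingularChain n X)
    (hf : ∀ v, l1Norm (f v) ≤ 1) :
    l1Norm (∑ v ∈ F, f v - ∑ v ∈ F, f (v + g)) ≤
      2 * ((F \ F.map (addRightEmbedding g)).card : ℝ) := by
  have h1 : ∑ v ∈ F, f (v + g) = ∑ v ∈ F.map (addRightEmbedding g), f v := by
    simp [Finset.sum_map]
  rw [h1, ← Finset.sum_sdiff_sub_sum_sdiff, two_mul]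
  refine (l1Norm_sub_le _ _).trans ?_
  nth_rewrite 2 [Finset.card_sdiff_comm (Finset.card_map _).symm]
  refine add_le_add ?_ ?_ <;>
  · refine (l1Norm_sum_le _ _).trans ((Finset.sum_le_sum fun v _ => hf v).trans_eq ?_)
    simp

/-- The average of the cones with apices at the integer points of a cube, pushed forward to `T`. -/
noncomputable def pushCone (n : ℕ) (π : C(Fin d → ℝ, T)) (N : ℕ) :
    SingularChain n (Fin d → ℝ) →ₗ[ℝ] SingularChain (n + 1) T :=
  push (n + 1) π ∘ₗ coneAverage n (intBox d N) fun g i => (g i : ℝ)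

theorem pushCone_single (π : C(Fin d → ℝ, T)) (N : ℕ) (σ : SingularSimplex n (Fin d → ℝ)) :
    pushCone n π N (Finsupp.single σ 1) = ((intBox d N).card : ℝ)⁻¹ • ∑ g ∈ intBox d N,
      Finsupp.single (π.comp (SingularSimplex.cone (fun i => (g i : ℝ)) σ)) 1 := by
  simp [pushCone, coneAverage_apply]

theorem l1Norm_pushCone_single_le (π : C(Fin d → ℝ, T)) (N : ℕ)
    (σ : SingularSimplex n (Fin d → ℝ)) : l1Norm (pushCone n π N (Finsupp.single σ 1)) ≤ 1 := by
  rw [pushCone_single, l1Norm_smul, abs_of_nonneg (by positivity)]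
  refine (mul_le_mul_of_nonneg_left (l1Norm_sum_le _ _) (by positivity)).trans ?_
  simpa using inv_mul_le_one

/-- Two lifts of a singular simplex have averaged cones that agree asymptotically. -/
theorem tendsto_l1Norm_pushCone_translate {π : C(Fin d → ℝ, T)}
    (hper : ∀ x (g : Fin d → ℤ), π (x + fun i => (g i : ℝ)) = π x)
    (σ : SingularSimplex n (Fin d → ℝ)) (g : Fin d → ℤ) :
    Tendsto (fun N => l1Norm (pushCone n π N
      (Finsupp.single (σ + ContinuousMap.const _ fun i => (g i : ℝ)) 1 - Finsupp.single σ 1)))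
      atTop (𝓝 0) := by
  refine squeeze_zero (fun _ => l1Norm_nonneg _) (fun N => ?_)
    (by simpa using (tendsto_card_intBox_sdiff d g).const_mul 2)
  let τ := σ + ContinuousMap.const _ fun i => (g i : ℝ)
  let f : (Fin d → ℤ) → SingularChain (n + 1) T := fun v =>
    Finsupp.single (π.comp (SingularSimplex.cone (fun i => (v i : ℝ)) τ)) 1
  have hf (v : Fin d → ℤ) :
      Finsupp.single (π.comp (SingularSimplex.cone (fun i => (v i : ℝ)) σ)) 1 = f (v + g) := by
    have hv : (fun i => ((v + g) i : ℝ)) = (fun i => (v i : ℝ)) + fun i => (g i : ℝ) := by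
      ext i
      simp
    simp only [f, τ, hv, SingularSimplex.cone_add_const]
    congr 1
    ext t
    exact (hper _ g).symm
  rw [map_sub, pushCone_single, pushCone_single, ← smul_sub, l1Norm_smul,
    abs_of_nonneg (by positivity), Finset.sum_congr rfl fun v _ => hf v]
  refine (mul_le_mul_of_nonneg_left (l1Norm_sum_translate_sub_sum_le (intBox d N) g f
    fun v => by simp [f]) (by positivity)).trans_eq ?_
  ring

/-- Asymptotically, the averaged cone of a chain is bounded by the norm of its pushforward. -/
theorem exists_l1Norm_pushCone_le {π : C(Fin d → ℝ, T)}
    (hper : ∀ x (g : Fin d → ℤ), π (x + fun i => (g i : ℝ)) = π x)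
    (hlift : ∀ σ : SingularSimplex n T, ∃ τ : SingularSimplex n (Fin d → ℝ), π.comp τ = σ)
    (huniq : ∀ τ τ' : SingularSimplex n (Fin d → ℝ), π.comp τ = π.comp τ' →
      ∃ g : Fin d → ℤ, τ' = τ + ContinuousMap.const _ fun i => (g i : ℝ))
    (w : SingularChain n (Fin d → ℝ)) {ε : ℝ} (hε : 0 < ε) :
    ∃ N, 0 < N ∧ l1Norm (pushCone n π N w) ≤ l1Norm (push n π w) + ε := by
  choose L hL using hlift
  let S : SingularChain n T →ₗ[ℝ] SingularChain n (Fin d → ℝ) := Finsupp.lmapDomain ℝ ℝ L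
  have hS (σ : SingularSimplex n T) (a : ℝ) :
      S (Finsupp.single σ a) = Finsupp.single (L σ) a := Finsupp.mapDomain_single
  -- `Φ N` measures the error of replacing each simplex by the chosen lift of its projection. It
  -- tends to zero on each simplex, hence on the finitely many simplices of `w`.
  let Φ (N : ℕ) := pushCone n π N ∘ₗ (LinearMap.id - S ∘ₗ push n π)
  have hΦ (σ : SingularSimplex n (Fin d → ℝ)) :
      Tendsto (fun N => l1Norm (Φ N (Finsupp.single σ 1))) atTop (𝓝 0) := by
    obtain ⟨g, hg⟩ := huniq (L (π.comp σ)) σ (hL _)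
    refine (tendsto_l1Norm_pushCone_translate hper (L (π.comp σ)) g).congr fun N => ?_
    simp [Φ, hS, ← hg]
  have hsum : Tendsto
      (fun N => w.sum fun σ a => |a| * l1Norm (Φ N (Finsupp.single σ 1))) atTop (𝓝 0) := by
    simpa [Finsupp.sum] using tendsto_finsetSum w.support fun σ _ => (hΦ σ).const_mul |w σ|
  obtain ⟨N, hN, hN0⟩ := ((hsum.eventually_lt_const hε).and (eventually_gt_atTop 0)).exists
  refine ⟨N, hN0, ?_⟩
  have hdec : pushCone n π N w = (pushCone n π N ∘ₗ S) (push n π w) + Φ N w := by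
    simp [Φ]
  rw [hdec]
  refine (l1Norm_add_le _ _).trans (add_le_add ?_ ((l1Norm_map_le _ _).trans hN.le))
  refine l1Norm_map_le_of_le_one _ (fun σ => ?_) _
  rw [LinearMap.comp_apply, hS]
  exact l1Norm_pushCone_single_le _ _ _

theorem push_surjective {X Y : Type*} [TopologicalSpace X] [TopologicalSpace Y] {f : C(X, Y)}
    (hlift : ∀ σ : SingularSimplex n Y, ∃ τ : SingularSimplex n X, f.comp τ = σ) :
    Function.Surjective (push n f) :=
  Finsupp.mapDomain_surjective hlift

/-- Every boundary is bounded by a chain whose norm is at most its own norm plus `ε`. -/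
theorem exists_boundary_eq_l1Norm_le_add {π : C(Fin d → ℝ, T)}
    (hper : ∀ x (g : Fin d → ℤ), π (x + fun i => (g i : ℝ)) = π x)
    (hlift : ∀ (n : ℕ) (σ : SingularSimplex n T),
      ∃ τ : SingularSimplex n (Fin d → ℝ), π.comp τ = σ)
    (huniq : ∀ τ τ' : SingularSimplex n (Fin d → ℝ), π.comp τ = π.comp τ' →
      ∃ g : Fin d → ℤ, τ' = τ + ContinuousMap.const _ fun i => (g i : ℝ))
    (c : SingularChain (n + 1) T) {ε : ℝ} (hε : 0 < ε) :
    ∃ c' : SingularChain (n + 1) T, boundary n T c' = boundary n T c ∧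
      l1Norm c' ≤ l1Norm (boundary n T c) + ε := by
  obtain ⟨b, rfl⟩ := push_surjective (hlift (n + 1)) c
  obtain ⟨N, hN, hle⟩ := exists_l1Norm_pushCone_le hper (hlift n) huniq (boundary n _ b) hε
  refine ⟨pushCone n π N (boundary n _ b), ?_, by rwa [boundary_push]⟩
  have hF : (intBox d N).Nonempty := by
    rw [← Finset.card_pos, card_intBox]
    exact pow_pos hN d
  have h := boundary_coneAverage hF (fun g i => (g i : ℝ)) b
  -- With $A$ the averaged cone, $A(\partial b)=b-\partial A(b)$, so the new chain differs from the
  -- projection of `b` by a boundary.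
  have h' : pushCone n π N (boundary n _ b) =
      push (n + 1) π b - boundary (n + 1) T (push (n + 2) π
        (coneAverage (n + 1) (intBox d N) (fun g i => (g i : ℝ)) b)) := by
    rw [boundary_push, h, map_sub, sub_sub_cancel]
    rfl
  rw [h', map_sub, boundary_boundary, sub_zero]

end SingularChain

/-! ### Lifting simplices to the universal cover -/

/-- The universal covering of the standard torus. -/
def torusCovering (d : ℕ) : C(Fin d → ℝ, Fin d → UnitAddCircle) where
  toFun x i := (x i : UnitAddCircle)
  continuous_toFun := by
    refine continuous_pi fun i => ?_
    exact (AddCircle.continuous_mk' 1).comp (continuous_apply i)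

theorem torusCovering_apply (d : ℕ) (x : Fin d → ℝ) (i : Fin d) :
    torusCovering d x i = (x i : UnitAddCircle) := rfl

theorem torusCovering_add_intCast (d : ℕ) (x : Fin d → ℝ) (g : Fin d → ℤ) :
    torusCovering d (x + fun i => (g i : ℝ)) = torusCovering d x := by
  ext i
  simp [torusCovering_apply]

theorem exists_lift_torusCovering {n d : ℕ} (σ : SingularSimplex n (Fin d → UnitAddCircle)) :
    ∃ τ : SingularSimplex n (Fin d → ℝ), (torusCovering d).comp τ = σ := by
  have hconv : Convex ℝ (stdSimplex ℝ (Fin (n + 1))) := convex_stdSimplex ℝ _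
  have : ContractibleSpace (stdSimplex ℝ (Fin (n + 1))) :=
    hconv.contractibleSpace ⟨_, single_mem_stdSimplex ℝ 0⟩
  have : LocallyPathConnectedSpace (stdSimplex ℝ (Fin (n + 1))) :=
    hconv.locallyPathConnectedSpace
  have h (i : Fin d) : ∃ F : C(stdSimplex ℝ (Fin (n + 1)), ℝ),
      ∀ t, (F t : UnitAddCircle) = σ t i := by
    let f : C(stdSimplex ℝ (Fin (n + 1)), UnitAddCircle) :=
      ⟨fun t => σ t i, (continuous_apply i).comp (map_continuous σ)⟩
    obtain ⟨e, he⟩ := QuotientAddGroup.mk_surjective (f (Classical.arbitrary _))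
    obtain ⟨F, ⟨-, hF⟩, -⟩ :=
      (AddCircle.isCoveringMap_coe (1 : ℝ)).existsUnique_continuousMap_lifts f _ e he
    exact ⟨F, congrFun hF⟩
  choose F hF using h
  refine ⟨⟨fun t i => F i t, continuous_pi fun i => map_continuous (F i)⟩, ?_⟩
  ext t i
  exact hF i t

/-- The difference is integral at one point; uniqueness of lifts on the connected simplex makes it
constant. -/
theorem eq_add_const_of_torusCovering_comp_eq {n d : ℕ} {τ τ' : SingularSimplex n (Fin d → ℝ)}
    (h : (torusCovering d).comp τ = (torusCovering d).comp τ') :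
    ∃ g : Fin d → ℤ, τ' = τ + ContinuousMap.const _ fun i => (g i : ℝ) := by
  have hcoe (i : Fin d) (t) : (τ t i : UnitAddCircle) = τ' t i :=
    congrFun (DFunLike.congr_fun h t) i
  let t₀ : stdSimplex ℝ (Fin (n + 1)) := Classical.arbitrary _
  have hg (i : Fin d) : ∃ m : ℤ, (m : ℝ) = τ' t₀ i - τ t₀ i := by
    obtain ⟨m, hm⟩ := (AddCircle.coe_eq_zero_iff (1 : ℝ) (x := τ' t₀ i - τ t₀ i)).mp
      (by rw [AddCircle.coe_sub, hcoe, sub_self])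
    exact ⟨m, by simpa using hm⟩
  choose g hg using hg
  refine ⟨g, ContinuousMap.ext fun t => funext fun i => ?_⟩
  refine congrFun ((AddCircle.isCoveringMap_coe (1 : ℝ)).eq_of_comp_eq
    (g₁ := fun t => τ' t i) (g₂ := fun t => τ t i + (g i : ℝ))
    ((continuous_apply i).comp (map_continuous τ'))
    (((continuous_apply i).comp (map_continuous τ)).add continuous_const)
    (funext fun u => ?_) t₀ (by simp [hg])) t
  have h0 : ((g i : ℝ) : UnitAddCircle) = 0 := (AddCircle.coe_eq_zero_iff 1).mpr ⟨g i, by simp⟩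
  change (τ' u i : UnitAddCircle) = ((τ u i + (g i : ℝ) : ℝ) : UnitAddCircle)
  rw [AddCircle.coe_add, h0, add_zero, hcoe]

theorem lemma3p6 (d s : ℕ) (hd : 1 ≤ d) :
    ∃ K : ℝ, ∀ (T : Type*) [TopologicalSpace T], IsTorus d T →
      ∀ z : SingularChain s T, SingularChain.IsCycle z → SingularChain.IsNullHomologous z →
        ∃ c : SingularChain (s + 1) T,
          SingularChain.boundary s T c = z ∧
            SingularChain.l1Norm c ≤ K * SingularChain.l1Norm z := by
  -- The 2 comes from taking $\varepsilon=\|z\|_1$, which is positive only for $z\ne0$; hence the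
  -- separate zero case.
  refine ⟨2, fun T _ hT z _ hz => ?_⟩
  obtain ⟨e⟩ := hT
  obtain ⟨c, rfl⟩ := hz
  by_cases hz : SingularChain.boundary s T c = 0
  · exact ⟨0, by simp [hz], by simp [hz]⟩
  let π : C(Fin d → ℝ, T) := (e.symm : C(_, T)).comp (torusCovering d)
  have hπ (n : ℕ) (τ : SingularSimplex n (Fin d → ℝ)) (t) :
      π.comp τ t = e.symm (torusCovering d (τ t)) := rfl
  obtain ⟨c', hc', hle⟩ := SingularChain.exists_boundary_eq_l1Norm_le_add (π := π)
    (fun x g => congrArg e.symm (torusCovering_add_intCast d x g))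
    (fun n σ => by
      obtain ⟨τ, hτ⟩ := exists_lift_torusCovering ((e : C(T, Fin d → UnitAddCircle)).comp σ)
      refine ⟨τ, ContinuousMap.ext fun t => ?_⟩
      rw [hπ, e.symm_apply_eq]
      exact DFunLike.congr_fun hτ t)
    (fun τ τ' h => eq_add_const_of_torusCovering_comp_eq <| ContinuousMap.ext fun t =>
      e.symm.injective (DFunLike.congr_fun h t))
    c (SingularChain.l1Norm_pos hz)
  exact ⟨c', hc', by rwa [two_mul]⟩
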